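/- Let $\mathbb F_q$ be a finite field, let $\theta=\sum_{n\ge 1} b_n t^{-n}\in\mathbb F_q((t^{-1}))$, and let $[a_0;a_1,a_2,\dots]$ be its continued fraction expansion with partial quotients $a_k\in\mathbb F_q[t]$ (finite if $\theta\in\mathbb F_q(t)$). For $k\ge1$ put $d_k=\deg a_k$ and $i_k=d_1+\dots+d_k$, and for integers $d\ge 0$, $k\ge 1$ put $$e_\theta(d,k)=\frac{\sum_{k'=1}^k\max\{d_{k'}-d,0\}}{\sum_{k'=1}^k d_{k'}}.$$ For $n>m\ge0$ let $\mathfrak T_{m,n}(\theta)=\det\big(b_{n+j-i}\big)_{0\le i,j\le m}\in\mathbb F_q$; also let $\mathfrak T_{-1,n}(\theta)=1$ for $n\ge 0$, and $\mathfrak T_{m,n}(\theta)=0$ for $m<-1$ and $n\ge -m-1$. The (diagonally aligned) number wall of $\theta$ is the array $\mathfrak F(\theta)=\{\mathfrak F_{m,n}(\theta)\}_{m\ge0,\,n\ge1}$ with $$\mathfrak F_{m,n}(\theta)=\begin{cases}\mathfrak T_{\frac{m-n-1}{2},\frac{m+n-1}{2}}(\theta)& m\not\equiv n \pmod 2,\\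 0& m\equiv n\pmod 2.\end{cases}$$ For integers $m_1<m_2$ and a sequence $P:[m_1,m_2]\to\mathbb F_q$ (indexed by the integers in $[m_1,m_2]$) which is not identically zero, put $h_P(i)=\min_{P(i')\ne0}|i'-i|$ and, for integers $d\ge 0$, $$E_P(d)=\frac{\#\{m_1\le i<m_2:\max\{h_P(i),h_P(i+1)\}>d\}}{m_2-m_1}.$$ Then for every integer $d\ge0$ and every $k\ge1$ for which $a_k$ exists, $i_k>0$, the sequence $(\mathfrak F_{m,1}(\theta))_{0\le m\le 2i_k}$ is not identically zero, and $$e_\theta(d,k)=E_{P}(d),\qquad P=\mathfrak F(\theta)|_{[0,2i_k]\times\{1\}}.$$ -/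

import Mathlib

open scoped LaurentSeries Polynomial

noncomputable section

/-! The field `F((t⁻¹))` is modelled by Mathlib's field `F⸨X⸩` of Laurent series, the variable `X`
playing the role of `t⁻¹`: the coefficient of `t⁻ⁿ` of `θ` is `θ.coeff n`. -/

namespace EscapeOfMass

variable {F : Type*} [Field F]

/-- The element `t = X⁻¹` of `F((t⁻¹))`. -/
def t : F⸨X⸩ := HahnSeries.single (-1 : ℤ) (1 : F)

/-- The inclusion `F[t] → F((t⁻¹))`, evaluation of polynomials at `t = X⁻¹`. -/
def ofPoly (p : F[X]) : F⸨X⸩ := Polynomial.eval₂ HahnSeries.C t p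

/-- The polynomial part `∑_{n ≥ 0} b_{-n} tⁿ` of `θ = ∑ b_n t⁻ⁿ`. -/
def polyPart (θ : F⸨X⸩) : F[X] :=
  ∑ n ∈ Finset.range ((-θ.order).toNat + 1), Polynomial.monomial n (θ.coeff (-(n : ℤ)))

/-- The fractional part of `θ`, what remains of `θ` after removing its polynomial part. -/
def fracPart (θ : F⸨X⸩) : F⸨X⸩ := θ - ofPoly (polyPart θ)

/-- The complete quotients of the continued fraction algorithm over `F[t]`: start with `θ`; at each
step remove the polynomial part and invert. The value at `k` is meaningful only as long as no zero
has been inverted, see `HasPartialQuotient`. -/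
def completeQuotient (θ : F⸨X⸩) : ℕ → F⸨X⸩
  | 0 => θ
  | k + 1 => (fracPart (completeQuotient θ k))⁻¹

/-- The continued fraction expansion `[a₀; a₁, a₂, …]` of `θ` has a `k`-th partial quotient,
i.e. the algorithm does not stop before step `k`. For `θ` not in `F(t)` this holds for all `k`. -/
def HasPartialQuotient (θ : F⸨X⸩) (k : ℕ) : Prop :=
  ∀ j < k, fracPart (completeQuotient θ j) ≠ 0

/-- The `k`-th partial quotient `a_k ∈ F[t]` of `θ`. -/
def partialQuotient (θ : F⸨X⸩) (k : ℕ) : F[X] := polyPart (completeQuotient θ k)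

/-- `x_k = a_k + 1 / x_{k+1}`, so that `θ = [a₀; a₁, …, a_k, x_{k+1}]`. -/
theorem completeQuotient_eq (θ : F⸨X⸩) (k : ℕ) :
    completeQuotient θ k = ofPoly (partialQuotient θ k) + (completeQuotient θ (k + 1))⁻¹ := by
  rw [completeQuotient, inv_inv, fracPart, partialQuotient, add_sub_cancel]

/-- `d_k = deg a_k`. -/
def quotientDegree (θ : F⸨X⸩) (k : ℕ) : ℕ := (partialQuotient θ k).natDegree

/-- `i_k = d_1 + ⋯ + d_k`. -/
def degreeSum (θ : F⸨X⸩) (k : ℕ) : ℕ := ∑ k' ∈ Finset.Icc 1 k, quotientDegree θ k'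

/-- `e_θ(d, k)`: the mass of `θ` which lies above `d` up to the `k`-th partial quotient. -/
def cfEscape (θ : F⸨X⸩) (d k : ℕ) : ℚ :=
  (∑ k' ∈ Finset.Icc 1 k, max ((quotientDegree θ k' : ℚ) - (d : ℚ)) 0) /
    ∑ k' ∈ Finset.Icc 1 k, (quotientDegree θ k' : ℚ)

/-- The Toeplitz determinants `T_{m,n}(θ) = det (b_{n+j-i})_{0 ≤ i, j ≤ m}` for `m ≥ 0`, extended by
`T_{-1,n} = 1` and `T_{m,n} = 0` for `m < -1` (used only where `n ≥ |m + 1|`). -/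
def toeplitz (θ : F⸨X⸩) (m n : ℤ) : F :=
  if m < -1 then 0
  else if m = -1 then 1
  else (Matrix.of fun i j : Fin (m.toNat + 1) => θ.coeff (n + (j : ℤ) - (i : ℤ))).det

/-- The (diagonally-aligned) number wall `𝔉_{m,n}(θ)`, for rows `m ≥ 0` and columns `n ≥ 1`. -/
def numberWall (θ : F⸨X⸩) (m n : ℤ) : F :=
  if Even (m - n) then 0 else toeplitz θ ((m - n - 1) / 2) ((m + n - 1) / 2)

/-- The height `h_P(i) = min_{P(i') ≠ 0} |i' - i|` of the restriction of `P` to `[m₁, m₂]`. -/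
def seqHeight (P : ℤ → F) (m₁ m₂ i : ℤ) : ℕ :=
  sInf {h : ℕ | ∃ i' ∈ Set.Icc m₁ m₂, P i' ≠ 0 ∧ h = (i' - i).natAbs}

/-- `E_P(d)`: the mass above height `d` of the restriction of `P` to `[m₁, m₂]`. -/
def seqEscape (P : ℤ → F) (m₁ m₂ : ℤ) (d : ℕ) : ℚ :=
  (((Finset.Ico m₁ m₂).filter fun i =>
      d < max (seqHeight P m₁ m₂ i) (seqHeight P m₁ m₂ (i + 1))).card : ℚ) / ((m₂ - m₁ : ℤ) : ℚ)

end EscapeOfMass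

end

namespace EscapeOfMass

variable {F : Type*} [Field F]

/-! The first column vanishes at odd rows, and row 2r carries an r × r Toeplitz determinant. Its
kernel vectors are the coefficient vectors of polynomials q of degree < r for which the coefficients
of t⁻¹, …, t⁻ʳ in qθ vanish; this is `HasGoodApprox`. One Gauss step θ ↦ {1/θ} lowers r by d_1, so
by induction such a nonzero q fails to exist, for r ≤ i_k, exactly when r is some i_j with 0 ≤ j ≤ k
(`hasGoodApprox_iff`).

Hence the nonzero entries of the column up to row 2i_k sit at the rows 2i_j. A gap of length 2d_j
contributes 2 max(d_j - d, 0) indices to the count (`card_filter_seqHeight_gap`); summing over the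
gaps and dividing by 2i_k gives e_θ(d, k). -/

/-! ### Coefficients of polynomials and of fractional parts -/

theorem ofPoly_add (p q : F[X]) : ofPoly (p + q) = ofPoly p + ofPoly q :=
  Polynomial.eval₂_add _ _

theorem ofPoly_mul (p q : F[X]) : ofPoly (p * q) = ofPoly p * ofPoly q :=
  Polynomial.eval₂_mul _ _

theorem t_pow (n : ℕ) : (t : F⸨X⸩) ^ n = HahnSeries.single (-(n : ℤ)) 1 := by
  simp [t, HahnSeries.single_pow]

theorem ofPoly_monomial (n : ℕ) (a : F) :
    ofPoly (Polynomial.monomial n a) = HahnSeries.single (-(n : ℤ)) a := by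
  rw [ofPoly, Polynomial.eval₂_monomial, t_pow, HahnSeries.C_apply, HahnSeries.single_mul_single]
  simp

theorem coeff_ofPoly_mul (p : F[X]) (θ : F⸨X⸩) (m : ℤ) :
    (ofPoly p * θ).coeff m = p.sum fun j a => a * θ.coeff (m + j) := by
  induction p using Polynomial.induction_on' with
  | add p q hp hq =>
    rw [ofPoly_add, add_mul, HahnSeries.coeff_add, hp, hq,
      Polynomial.sum_add_index p q _ (by simp) (by intros; ring)]
  | monomial n a =>
    rw [ofPoly_monomial, Polynomial.sum_monomial_index _ _ (by simp)]
    have := HahnSeries.coeff_single_mul_add (r := a) (x := θ) (a := m + n) (b := -(n : ℤ))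
    simpa using this

theorem coeff_ofPoly (p : F[X]) (n : ℤ) :
    (ofPoly p).coeff n = if n ≤ 0 then p.coeff (-n).toNat else 0 := by
  induction p using Polynomial.induction_on' with
  | add p q hp hq =>
    rw [ofPoly_add, HahnSeries.coeff_add, hp, hq]
    split_ifs <;> simp
  | monomial k a =>
    rw [ofPoly_monomial, HahnSeries.coeff_single, Polynomial.coeff_monomial]
    split_ifs <;> first | rfl | omega

theorem coeff_polyPart (θ : F⸨X⸩) (n : ℕ) : (polyPart θ).coeff n = θ.coeff (-(n : ℤ)) := by
  simp only [polyPart, Polynomial.finsetSum_coeff, Polynomial.coeff_monomial]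
  rw [Finset.sum_ite_eq']
  split_ifs with h
  · rfl
  · rw [HahnSeries.coeff_eq_zero_of_lt_order]
    simp only [Finset.mem_range] at h
    omega

theorem coeff_fracPart (θ : F⸨X⸩) (n : ℤ) :
    (fracPart θ).coeff n = if n ≤ 0 then 0 else θ.coeff n := by
  rw [fracPart, HahnSeries.coeff_sub, coeff_ofPoly]
  split_ifs with h
  · rw [coeff_polyPart, show -((-n).toNat : ℤ) = n by omega, sub_self]
  · simp

/-! ### The valuation of θ and the degree of its first partial quotient -/

theorem lt_addVal_iff (x : F⸨X⸩) (r : ℤ) :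
    (r : WithTop ℤ) < HahnSeries.addVal ℤ F x ↔ ∀ n ≤ r, x.coeff n = 0 := by
  rw [HahnSeries.addVal_apply]
  constructor
  · intro h n hn
    exact HahnSeries.coeff_eq_zero_of_lt_orderTop (lt_of_le_of_lt (by exact_mod_cast hn) h)
  · intro h
    by_cases hx : x = 0
    · simp [hx]
    · rw [← HahnSeries.order_eq_orderTop_of_ne_zero hx]
      by_contra hc
      rw [not_lt] at hc
      exact HahnSeries.coeff_order_eq_zero.not.2 hx (h _ (by exact_mod_cast hc))

theorem addVal_ofPoly {p : F[X]} (hp : p ≠ 0) :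
    HahnSeries.addVal ℤ F (ofPoly p) = ((-(p.natDegree : ℤ) : ℤ) : WithTop ℤ) := by
  refine le_antisymm (HahnSeries.addVal_le_of_coeff_ne_zero ?_) ?_
  · rw [coeff_ofPoly, if_pos (by omega)]
    simpa using hp
  · have h : ((-(p.natDegree : ℤ) - 1 : ℤ) : WithTop ℤ) < HahnSeries.addVal ℤ F (ofPoly p) := by
      rw [lt_addVal_iff]
      intro n hn
      rw [coeff_ofPoly, if_pos (by omega)]
      exact Polynomial.coeff_eq_zero_of_natDegree_lt (by omega)
    revert h
    cases HahnSeries.addVal ℤ F (ofPoly p) with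
    | top => simp
    | coe v => norm_cast; omega

theorem addVal_fracPart_pos (θ : F⸨X⸩) : 0 < HahnSeries.addVal ℤ F (fracPart θ) := by
  have := (lt_addVal_iff (fracPart θ) 0).2 fun n hn => by rw [coeff_fracPart, if_pos hn]
  simpa using this

theorem fracPart_eq_self {θ : F⸨X⸩} (hθ : ∀ n ≤ 0, θ.coeff n = 0) : fracPart θ = θ := by
  ext n
  rw [coeff_fracPart]
  split_ifs with h
  · rw [hθ n h]
  · rfl

theorem polyPart_inv_ne_zero {θ : F⸨X⸩} (h0 : θ ≠ 0) (hθ : 0 < HahnSeries.addVal ℤ F θ) :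
    polyPart θ⁻¹ ≠ 0 := by
  intro ha
  have h1 := addVal_fracPart_pos θ⁻¹
  have h2 : fracPart θ⁻¹ = θ⁻¹ := by simp [fracPart, ha, ofPoly]
  have h3 : HahnSeries.addVal ℤ F (θ * θ⁻¹) = 0 := by
    rw [mul_inv_cancel₀ h0, AddValuation.map_one]
  rw [h2] at h1
  rw [AddValuation.map_mul] at h3
  exact (lt_of_lt_of_le hθ (le_add_of_nonneg_right h1.le)).ne' h3

/-- In θ⁻¹ the polynomial part dominates the fractional part, so θ⁻¹ has the valuation of its
polynomial part. -/
theorem addVal_eq_natDegree_polyPart_inv {θ : F⸨X⸩} (h0 : θ ≠ 0)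
    (hθ : 0 < HahnSeries.addVal ℤ F θ) :
    HahnSeries.addVal ℤ F θ = (((polyPart θ⁻¹).natDegree : ℤ) : WithTop ℤ) := by
  have ha := addVal_ofPoly (polyPart_inv_ne_zero h0 hθ)
  have hf := addVal_fracPart_pos θ⁻¹
  have h1 : HahnSeries.addVal ℤ F θ⁻¹ = ((-((polyPart θ⁻¹).natDegree : ℤ) : ℤ) : WithTop ℤ) := by
    have h2 : ofPoly (polyPart θ⁻¹) + fracPart θ⁻¹ = θ⁻¹ := by rw [fracPart]; ring
    rw [← ha]
    conv_lhs => rw [← h2]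
    refine AddValuation.map_add_eq_of_lt_left _ (lt_of_le_of_lt ?_ hf)
    rw [ha]
    exact_mod_cast (by omega : -((polyPart θ⁻¹).natDegree : ℤ) ≤ 0)
  have h3 : HahnSeries.addVal ℤ F (θ * θ⁻¹) = 0 := by
    rw [mul_inv_cancel₀ h0, AddValuation.map_one]
  rw [AddValuation.map_mul, h1] at h3
  revert h3
  cases HahnSeries.addVal ℤ F θ with
  | top => simp
  | coe v => norm_cast; omega

theorem natDegree_polyPart_inv_pos {θ : F⸨X⸩} (h0 : θ ≠ 0)
    (hθ : 0 < HahnSeries.addVal ℤ F θ) : 0 < (polyPart θ⁻¹).natDegree := by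
  rw [addVal_eq_natDegree_polyPart_inv h0 hθ] at hθ
  exact_mod_cast hθ

/-! ### Good approximations under the Gauss map -/

/-- Some nonzero polynomial of degree less than `r` multiplies `θ` to distance less than `|t|⁻ʳ` from
a polynomial. -/
def HasGoodApprox (θ : F⸨X⸩) (r : ℕ) : Prop :=
  ∃ q p : F[X], q ≠ 0 ∧ q.natDegree < r ∧
    ((r : ℤ) : WithTop ℤ) < HahnSeries.addVal ℤ F (ofPoly q * θ - ofPoly p)

theorem not_hasGoodApprox_zero (θ : F⸨X⸩) : ¬ HasGoodApprox θ 0 := by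
  rintro ⟨q, p, -, h, -⟩
  omega

theorem hasGoodApprox_of_lt {θ : F⸨X⸩} (h0 : θ ≠ 0) (hθ : 0 < HahnSeries.addVal ℤ F θ) {r : ℕ}
    (hr : 0 < r) (hrd : r < (polyPart θ⁻¹).natDegree) : HasGoodApprox θ r := by
  refine ⟨1, 0, one_ne_zero, by simpa using hr, ?_⟩
  have : ofPoly (1 : F[X]) * θ - ofPoly (0 : F[X]) = θ := by simp [ofPoly]
  rw [this, addVal_eq_natDegree_polyPart_inv h0 hθ]
  exact_mod_cast hrd

/-- The old numerator p becomes the new denominator: if x = qθ - p and θ⁻¹ = a + θ', then pθ' - (q -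
pa) = -x/θ. Dividing by θ costs valuation d, and deg p = deg q - d, so both bounds drop by d. -/
theorem hasGoodApprox_iff_fracPart_inv {θ : F⸨X⸩} (h0 : θ ≠ 0)
    (hθ : 0 < HahnSeries.addVal ℤ F θ) {r : ℕ} (hr : (polyPart θ⁻¹).natDegree ≤ r) :
    HasGoodApprox θ r ↔ HasGoodApprox (fracPart θ⁻¹) (r - (polyPart θ⁻¹).natDegree) := by
  have hv := addVal_eq_natDegree_polyPart_inv h0 hθ
  set a := polyPart θ⁻¹ with ha
  set d := a.natDegree
  have hinv : θ * (ofPoly a + fracPart θ⁻¹) = 1 := by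
    rw [fracPart, ← ha]
    simp [h0]
  set θ' := fracPart θ⁻¹
  constructor
  · rintro ⟨q, p, hq, hdeg, hx⟩
    set x := ofPoly q * θ - ofPoly p with hxdef
    have hqθ : HahnSeries.addVal ℤ F (ofPoly q * θ) = ((-(q.natDegree : ℤ) + d : ℤ) : WithTop ℤ) := by
      rw [AddValuation.map_mul, addVal_ofPoly hq, hv]
      rfl
    -- With p = 0, x = qθ has valuation at most d ≤ r, too small for a good approximation.
    have hp : p ≠ 0 := by
      rintro rfl
      have : x = ofPoly q * θ := by simp [hxdef, ofPoly]
      rw [this, hqθ] at hx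
      have := WithTop.coe_lt_coe.1 hx
      omega
    refine ⟨p, q - p * a, hp, ?_, ?_⟩
    · have h1 : (((d : ℤ) - r : ℤ) : WithTop ℤ) < HahnSeries.addVal ℤ F (ofPoly p) := by
        rw [show ofPoly p = ofPoly q * θ - x by rw [hxdef]; ring]
        refine lt_of_lt_of_le (lt_min ?_ ?_) (AddValuation.map_sub _ _ _)
        · rw [hqθ, WithTop.coe_lt_coe]
          omega
        · refine lt_of_le_of_lt ?_ hx
          rw [WithTop.coe_le_coe]
          omega
      rw [addVal_ofPoly hp, WithTop.coe_lt_coe] at h1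
      omega
    · have h1 : ofPoly p * θ' - ofPoly (q - p * a) = -(x * (ofPoly a + θ')) := by
        have h2 : ofPoly (q - p * a) = ofPoly q - ofPoly p * ofPoly a := by
          rw [← ofPoly_mul, eq_sub_iff_add_eq, ← ofPoly_add, sub_add_cancel]
        rw [h2, hxdef]
        linear_combination ofPoly q * hinv
      have h3 : θ * (ofPoly p * θ' - ofPoly (q - p * a)) = -x := by
        rw [h1]
        linear_combination (-x) * hinv
      have h4 := congrArg (HahnSeries.addVal ℤ F) h3
      rw [AddValuation.map_neg, AddValuation.map_mul, hv] at h4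
      rw [← h4] at hx
      revert hx
      cases HahnSeries.addVal ℤ F (ofPoly p * θ' - ofPoly (q - p * a)) with
      | top => exact fun _ => WithTop.coe_lt_top _
      | coe v =>
        rw [← WithTop.coe_add, WithTop.coe_lt_coe, WithTop.coe_lt_coe]
        omega
  · rintro ⟨p, s, hp, hdeg, hz⟩
    set z := ofPoly p * θ' - ofPoly s with hzdef
    have hpv := addVal_ofPoly hp
    set x := ofPoly (s + p * a) * θ - ofPoly p with hxdef
    have hxz : x = -(θ * z) := by
      rw [hxdef, hzdef, ofPoly_add, ofPoly_mul]
      linear_combination ofPoly p * hinv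
    have hx : ((r : ℤ) : WithTop ℤ) < HahnSeries.addVal ℤ F x := by
      rw [hxz, AddValuation.map_neg, AddValuation.map_mul, hv]
      revert hz
      cases HahnSeries.addVal ℤ F z with
      | top => exact fun _ => WithTop.coe_lt_top _
      | coe v =>
        rw [← WithTop.coe_add, WithTop.coe_lt_coe, WithTop.coe_lt_coe]
        omega
    have hpx : HahnSeries.addVal ℤ F (ofPoly (s + p * a) * θ) =
        ((-(p.natDegree : ℤ) : ℤ) : WithTop ℤ) := by
      rw [show ofPoly (s + p * a) * θ = ofPoly p + x by rw [hxdef]; ring, ← hpv]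
      refine AddValuation.map_add_eq_of_lt_left _ (lt_of_le_of_lt ?_ hx)
      rw [hpv, WithTop.coe_le_coe]
      omega
    have hq : s + p * a ≠ 0 := by
      intro hq
      rw [hq] at hpx
      simp only [ofPoly, Polynomial.eval₂_zero, zero_mul, AddValuation.map_zero] at hpx
      exact WithTop.top_ne_coe hpx
    refine ⟨s + p * a, p, hq, ?_, hx⟩
    rw [AddValuation.map_mul, addVal_ofPoly hq, hv, ← WithTop.coe_add, WithTop.coe_inj] at hpx
    omega

/-- At j = 0 the complete quotients θ⁻¹ and {θ⁻¹} may differ by a polynomial, so agreement for all j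
holds only after taking fractional parts. -/
theorem fracPart_completeQuotient_succ {θ : F⸨X⸩} (hθ : ∀ n ≤ 0, θ.coeff n = 0) (j : ℕ) :
    fracPart (completeQuotient θ (j + 1)) =
      fracPart (completeQuotient (fracPart θ⁻¹) j) := by
  induction j with
  | zero =>
    have h : ∀ n ≤ 0, (fracPart θ⁻¹).coeff n = 0 := fun n hn => by rw [coeff_fracPart, if_pos hn]
    simp only [completeQuotient]
    rw [fracPart_eq_self hθ, fracPart_eq_self h]
  | succ j ih => rw [completeQuotient, ih, completeQuotient]

theorem quotientDegree_one {θ : F⸨X⸩} (hθ : ∀ n ≤ 0, θ.coeff n = 0) :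
    quotientDegree θ 1 = (polyPart θ⁻¹).natDegree := by
  simp only [quotientDegree, partialQuotient, completeQuotient]
  rw [fracPart_eq_self hθ]

theorem quotientDegree_add_two {θ : F⸨X⸩} (hθ : ∀ n ≤ 0, θ.coeff n = 0) (j : ℕ) :
    quotientDegree θ (j + 2) = quotientDegree (fracPart θ⁻¹) (j + 1) := by
  rw [quotientDegree, partialQuotient, completeQuotient, fracPart_completeQuotient_succ hθ]
  rfl

theorem degreeSum_zero (θ : F⸨X⸩) : degreeSum θ 0 = 0 := rfl

theorem degreeSum_eq_sum_range (θ : F⸨X⸩) (k : ℕ) :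
    degreeSum θ k = ∑ j ∈ Finset.range k, quotientDegree θ (j + 1) := by
  rw [degreeSum, Finset.range_eq_Ico, Finset.sum_Ico_add' _ 0 k 1]
  rfl

theorem degreeSum_succ_eq {θ : F⸨X⸩} (hθ : ∀ n ≤ 0, θ.coeff n = 0) (k : ℕ) :
    degreeSum θ (k + 1) = degreeSum (fracPart θ⁻¹) k + (polyPart θ⁻¹).natDegree := by
  rw [degreeSum_eq_sum_range, degreeSum_eq_sum_range, Finset.sum_range_succ',
    quotientDegree_one hθ]
  simp only [quotientDegree_add_two hθ]

theorem degreeSum_succ (θ : F⸨X⸩) (k : ℕ) :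
    degreeSum θ (k + 1) = degreeSum θ k + quotientDegree θ (k + 1) := by
  rw [degreeSum_eq_sum_range, degreeSum_eq_sum_range, Finset.sum_range_succ]

theorem degreeSum_lt_succ {θ : F⸨X⸩} {k j : ℕ} (h : HasPartialQuotient θ k) (hj : j < k) :
    degreeSum θ j < degreeSum θ (j + 1) := by
  rw [degreeSum_succ, quotientDegree, partialQuotient, completeQuotient]
  have := natDegree_polyPart_inv_pos (h j hj) (addVal_fracPart_pos _)
  omega

/-- For 0 < r < d_1 the choice q = 1 works, and at r = 0 no q exists. For r ≥ d_1 a Gauss step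
reduces to {θ⁻¹}, which is why θ is quantified inside the induction. -/
theorem hasGoodApprox_iff (k : ℕ) : ∀ (θ : F⸨X⸩), (∀ n ≤ 0, θ.coeff n = 0) →
    HasPartialQuotient θ k → ∀ r ≤ degreeSum θ k,
      (HasGoodApprox θ r ↔ ∀ j ≤ k, r ≠ degreeSum θ j) := by
  induction k with
  | zero =>
    intro θ _ _ r hr
    obtain rfl : r = 0 := by simpa [degreeSum_zero] using hr
    simp [not_hasGoodApprox_zero, degreeSum_zero]
  | succ k ih =>
    intro θ hθ hpq r hr
    have h0 : θ ≠ 0 := by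
      have := hpq 0 k.succ_pos
      rwa [completeQuotient, fracPart_eq_self hθ] at this
    have hv : 0 < HahnSeries.addVal ℤ F θ := by simpa using (lt_addVal_iff θ 0).2 hθ
    have hd := natDegree_polyPart_inv_pos h0 hv
    by_cases hrd : (polyPart θ⁻¹).natDegree ≤ r
    · rw [hasGoodApprox_iff_fracPart_inv h0 hv hrd, ih]
      · constructor
        · intro h j hj
          cases j with
          | zero => rw [degreeSum_zero]; omega
          | succ j =>
            have := h j (by omega)
            rw [degreeSum_succ_eq hθ]
            omega
        · intro h j hj
          have := h (j + 1) (by omega)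
          rw [degreeSum_succ_eq hθ] at this
          omega
      · exact fun n hn => by rw [coeff_fracPart, if_pos hn]
      · intro j hj
        rw [← fracPart_completeQuotient_succ hθ]
        exact hpq (j + 1) (by omega)
      · rw [degreeSum_succ_eq hθ] at hr
        omega
    · rcases Nat.eq_zero_or_pos r with rfl | hr0
      · exact iff_of_false (not_hasGoodApprox_zero θ) fun h => h 0 (by omega) rfl
      · refine iff_of_true (hasGoodApprox_of_lt h0 hv hr0 (by omega)) fun j hj => ?_
        cases j with
        | zero => rw [degreeSum_zero]; omega
        | succ j => rw [degreeSum_succ_eq hθ]; omega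

/-! ### Zeros of the first column of the number wall -/

theorem numberWall_odd (θ : F⸨X⸩) (r : ℤ) : numberWall θ (2 * r + 1) 1 = 0 := by
  rw [numberWall, if_pos ⟨r, by ring⟩]

theorem numberWall_even (θ : F⸨X⸩) (r : ℤ) :
    numberWall θ (2 * r) 1 = toeplitz θ (r - 1) r := by
  rw [numberWall, if_neg (by rw [Int.not_even_iff_odd]; exact ⟨r - 1, by ring⟩)]
  congr 1 <;> omega

theorem numberWall_even_eq_zero_iff (θ : F⸨X⸩) (r : ℕ) :
    numberWall θ (2 * r) 1 = 0 ↔ HasGoodApprox θ r := by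
  rw [numberWall_even]
  cases r with
  | zero => simp [toeplitz, not_hasGoodApprox_zero]
  | succ s =>
    rw [toeplitz, if_neg (by omega), if_neg (by omega)]
    rw [show (((s + 1 : ℕ) : ℤ) - 1).toNat = s by omega]
    rw [← Matrix.exists_mulVec_eq_zero_iff]
    -- Row i of the matrix computes the coefficient of t^{-(s+1-i)} in qθ; as i runs over 0, …, s
    -- these are exactly the exponents -1, …, -r with r = s + 1.
    have key : ∀ (v : Fin (s + 1) → F) (q : F[X]), q.natDegree < s + 1 →
        (∀ j, q.coeff (j : Fin (s + 1)) = v j) → ∀ i : Fin (s + 1),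
        (Matrix.of fun i j : Fin (s + 1) =>
          θ.coeff (((s + 1 : ℕ) : ℤ) + (j : ℤ) - (i : ℤ))).mulVec v i =
          (ofPoly q * θ).coeff ((s + 1 : ℕ) - (i : ℤ)) := by
      intro v q hq hv i
      have hsum := Polynomial.sum_over_range' q
        (f := fun j a => a * θ.coeff ((s + 1 : ℕ) - (i : ℤ) + j)) (fun _ => zero_mul _) (s + 1) hq
      rw [coeff_ofPoly_mul, hsum, Finset.sum_range, Matrix.mulVec, dotProduct]
      refine Finset.sum_congr rfl fun j _ => ?_
      rw [hv, mul_comm, Matrix.of_apply]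
      congr 2
      ring
    constructor
    · rintro ⟨v, hv0, hv⟩
      set q : F[X] := ∑ j : Fin (s + 1), Polynomial.monomial j (v j) with hq
      have hcoeff : ∀ j, q.coeff (j : Fin (s + 1)) = v j := by
        intro j
        simp [hq, Polynomial.coeff_monomial, Fin.val_inj]
      have hdeg : q.natDegree < s + 1 := by
        rw [Nat.lt_succ_iff]
        refine Polynomial.natDegree_sum_le_of_forall_le (Finset.univ : Finset (Fin (s + 1)))
          (fun j => Polynomial.monomial (j : ℕ) (v j)) fun j _ => ?_
        exact (Polynomial.natDegree_monomial_le _).trans (by omega)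
      refine ⟨q, polyPart (ofPoly q * θ), ?_, hdeg, ?_⟩
      · intro h
        refine hv0 (funext fun j => ?_)
        rw [← hcoeff, h, Polynomial.coeff_zero, Pi.zero_apply]
      · rw [← fracPart, lt_addVal_iff]
        intro n hn
        rw [coeff_fracPart]
        split_ifs with hn0
        · rfl
        · have := key v q hdeg hcoeff ⟨s + 1 - n.toNat, by omega⟩
          rw [hv, Pi.zero_apply] at this
          rw [this]
          congr 1
          push_cast
          omega
    · rintro ⟨q, p, hq0, hdeg, h⟩
      rw [lt_addVal_iff] at h
      refine ⟨fun j => q.coeff j, ?_, ?_⟩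
      · intro hv
        exact hq0 (Polynomial.leadingCoeff_eq_zero.1 (congrFun hv ⟨q.natDegree, hdeg⟩))
      · ext i
        rw [key _ q hdeg (fun _ => rfl)]
        have := h ((s + 1 : ℕ) - (i : ℤ)) (by omega)
        rw [HahnSeries.coeff_sub, coeff_ofPoly, if_neg (by have := i.2; omega), sub_zero] at this
        exact this

theorem numberWall_ne_zero_iff {θ : F⸨X⸩} (hθ : ∀ n ≤ 0, θ.coeff n = 0) {k : ℕ}
    (hpq : HasPartialQuotient θ k) {m : ℤ} (hm : m ∈ Set.Icc (0 : ℤ) (2 * degreeSum θ k)) :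
    numberWall θ m 1 ≠ 0 ↔ ∃ j ≤ k, m = 2 * (degreeSum θ j : ℤ) := by
  obtain ⟨r, rfl | rfl⟩ := Int.even_or_odd' m
  · obtain ⟨h1, h2⟩ := hm
    lift r to ℕ using by omega
    rw [Ne, numberWall_even_eq_zero_iff, hasGoodApprox_iff k θ hθ hpq r (by omega)]
    push Not
    refine exists_congr fun j => and_congr_right fun _ => ?_
    omega
  · rw [numberWall_odd]
    refine iff_of_false (fun h => h rfl) ?_
    rintro ⟨j, -, h⟩
    omega

/-! ### Counting heights in the gaps between nonzero entries -/

theorem seqHeight_eq_min {P : ℤ → F} {m₁ m₂ a b i : ℤ} (hai : a ≤ i) (hib : i ≤ b)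
    (ha : a ∈ Set.Icc m₁ m₂) (hb : b ∈ Set.Icc m₁ m₂) (hPa : P a ≠ 0) (hPb : P b ≠ 0)
    (hP : ∀ m, a < m → m < b → P m = 0) :
    seqHeight P m₁ m₂ i = min (i - a).natAbs (b - i).natAbs := by
  refine IsLeast.csInf_eq ⟨?_, ?_⟩
  · rcases min_choice (i - a).natAbs (b - i).natAbs with h | h <;> rw [h]
    · exact ⟨a, ha, hPa, by omega⟩
    · exact ⟨b, hb, hPb, rfl⟩
  · rintro h ⟨i', -, hi', rfl⟩
    have : i' ≤ a ∨ b ≤ i' := by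
      by_contra! hc
      exact hi' (hP i' hc.1 hc.2)
    omega

/-- The height at a + s is min(s, 2δ - s), so d is exceeded at i or i + 1 exactly for a + d ≤ i < a
+ 2δ - d. Even length matters: a gap of length 2d + 1 would give a nonempty interval but never
exceed height d. -/
theorem card_filter_seqHeight_gap {P : ℤ → F} {m₁ m₂ a : ℤ} {δ d : ℕ}
    (ha : a ∈ Set.Icc m₁ m₂) (hb : a + 2 * δ ∈ Set.Icc m₁ m₂) (hPa : P a ≠ 0)
    (hPb : P (a + 2 * δ) ≠ 0) (hP : ∀ m, a < m → m < a + 2 * δ → P m = 0) :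
    ((Finset.Ico a (a + 2 * δ)).filter fun i =>
      d < max (seqHeight P m₁ m₂ i) (seqHeight P m₁ m₂ (i + 1))).card = 2 * (δ - d) := by
  have : ((Finset.Ico a (a + 2 * δ)).filter fun i =>
      d < max (seqHeight P m₁ m₂ i) (seqHeight P m₁ m₂ (i + 1))) =
      Finset.Ico (a + d) (a + 2 * δ - d) := by
    ext i
    rw [Finset.mem_filter, Finset.mem_Ico, Finset.mem_Ico]
    by_cases hi : a ≤ i ∧ i < a + 2 * δ
    · rw [seqHeight_eq_min (by omega) (by omega) ha hb hPa hPb hP,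
        seqHeight_eq_min (by omega) (by omega) ha hb hPa hPb hP]
      omega
    · omega
  rw [this, Int.card_Ico]
  omega

theorem card_filter_seqHeight {P : ℤ → F} {D : ℕ → ℕ} {k : ℕ} (hD0 : D 0 = 0)
    (hD : ∀ j < k, D j < D (j + 1))
    (hP : ∀ m ∈ Set.Icc (0 : ℤ) (2 * D k), P m ≠ 0 ↔ ∃ j ≤ k, m = 2 * (D j : ℤ)) (d : ℕ) :
    ((Finset.Ico (0 : ℤ) (2 * D k)).filter fun i =>
      d < max (seqHeight P 0 (2 * D k) i) (seqHeight P 0 (2 * D k) (i + 1))).card =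
      2 * ∑ j ∈ Finset.range k, (D (j + 1) - D j - d) := by
  have hmono : ∀ i j, i ≤ j → j ≤ k → D i ≤ D j := by
    intro i j hij hjk
    induction j, hij using Nat.le_induction with
    | base => rfl
    | succ j _ ih => exact (ih (by omega)).trans (hD j (by omega)).le
  have hmem : ∀ j ≤ k, (2 * D j : ℤ) ∈ Set.Icc (0 : ℤ) (2 * D k) := fun j hj => by
    have := hmono j k hj le_rfl
    exact ⟨by omega, by omega⟩
  have hne : ∀ j ≤ k, P (2 * D j) ≠ 0 := fun j hj => (hP _ (hmem j hj)).2 ⟨j, hj, rfl⟩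
  -- Only the counting range grows with l; heights stay relative to the full window [0, 2 D k].
  suffices ∀ l ≤ k, ((Finset.Ico (0 : ℤ) (2 * D l)).filter fun i =>
      d < max (seqHeight P 0 (2 * D k) i) (seqHeight P 0 (2 * D k) (i + 1))).card =
      2 * ∑ j ∈ Finset.range l, (D (j + 1) - D j - d) from this k le_rfl
  intro l
  induction l with
  | zero => simp [hD0]
  | succ l ih =>
    intro hl
    have hlt := hD l hl
    have hend : (2 * D (l + 1) : ℤ) = 2 * D l + 2 * (D (l + 1) - D l : ℕ) := by omega
    have hgap := card_filter_seqHeight_gap (P := P) (d := d) (δ := D (l + 1) - D l)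
      (hmem l (by omega)) (hend ▸ hmem (l + 1) hl) (hne l (by omega)) (hend ▸ hne (l + 1) hl) (by
        intro m h1 h2
        by_contra hm
        have := hmem (l + 1) hl
        have hm' : m ∈ Set.Icc (0 : ℤ) (2 * D k) := ⟨by omega, by have := this.2; omega⟩
        obtain ⟨j, hj, rfl⟩ := (hP m hm').1 hm
        rcases Nat.lt_or_ge l j with h | h
        · have := hmono (l + 1) j h hj
          omega
        · have := hmono j l h (by omega)
          omega)
    rw [← hend] at hgap
    rw [Finset.sum_range_succ, mul_add, ← ih (by omega), ← hgap,
      ← Finset.Ico_union_Ico_eq_Ico (a := (0 : ℤ)) (b := 2 * D l) (c := 2 * D (l + 1))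
        (by omega) (by omega), Finset.filter_union, Finset.card_union_of_disjoint]
    exact Finset.disjoint_filter_filter (Finset.Ico_disjoint_Ico_consecutive _ _ _)

end EscapeOfMass

/-- The hypothesis `hθ` says that `θ = ∑_{n ≥ 1} b_n t⁻ⁿ`. The first two conclusions say that the
fractions defining both sides have nonzero denominators and that the first column of the number wall
is not identically zero on rows `0, …, 2 i_k`, so that both sides are meaningful. -/
theorem proposition4p3 {F : Type*} [Field F] [Finite F] (θ : F⸨X⸩)
    (hθ : ∀ n : ℤ, n ≤ 0 → θ.coeff n = 0) (d k : ℕ) (hk : 1 ≤ k)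
    (hdef : EscapeOfMass.HasPartialQuotient θ k) :
    0 < EscapeOfMass.degreeSum θ k ∧
    (∃ m ∈ Set.Icc (0 : ℤ) (2 * (EscapeOfMass.degreeSum θ k : ℤ)),
      EscapeOfMass.numberWall θ m 1 ≠ 0) ∧
    EscapeOfMass.cfEscape θ d k =
      EscapeOfMass.seqEscape (fun m : ℤ => EscapeOfMass.numberWall θ m 1)
        0 (2 * (EscapeOfMass.degreeSum θ k : ℤ)) d := by
  have hpos : 0 < EscapeOfMass.degreeSum θ k := by
    obtain ⟨k, rfl⟩ := Nat.exists_eq_succ_of_ne_zero (by omega : k ≠ 0)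
    exact (Nat.zero_le _).trans_lt (EscapeOfMass.degreeSum_lt_succ hdef k.lt_succ_self)
  have hwall := fun m => EscapeOfMass.numberWall_ne_zero_iff hθ hdef (m := m)
  refine ⟨hpos, ⟨0, ⟨le_rfl, by omega⟩, (hwall 0 ⟨le_rfl, by omega⟩).2 ⟨0, by omega, rfl⟩⟩, ?_⟩
  have hcard := EscapeOfMass.card_filter_seqHeight
    (P := fun m : ℤ => EscapeOfMass.numberWall θ m 1) (D := EscapeOfMass.degreeSum θ)
    (EscapeOfMass.degreeSum_zero θ) (fun j => EscapeOfMass.degreeSum_lt_succ hdef) hwall d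
  rw [EscapeOfMass.seqEscape, hcard, EscapeOfMass.cfEscape]
  have hden : ∑ k' ∈ Finset.Icc 1 k, (EscapeOfMass.quotientDegree θ k' : ℚ) =
      EscapeOfMass.degreeSum θ k := by
    rw [EscapeOfMass.degreeSum]
    push_cast
    rfl
  have hnum : ∑ k' ∈ Finset.Icc 1 k,
      max ((EscapeOfMass.quotientDegree θ k' : ℚ) - (d : ℚ)) 0 =
      ((∑ j ∈ Finset.range k, (EscapeOfMass.degreeSum θ (j + 1) - EscapeOfMass.degreeSum θ j - d) :
        ℕ) : ℚ) := by
    -- Truncated subtraction in ℕ plays the role of max(·, 0).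
    have hterm : ∀ j, ((EscapeOfMass.degreeSum θ (j + 1) - EscapeOfMass.degreeSum θ j - d : ℕ) : ℚ) =
        max ((EscapeOfMass.quotientDegree θ (j + 1) : ℚ) - (d : ℚ)) 0 := fun j => by
      rw [EscapeOfMass.degreeSum_succ, Nat.add_sub_cancel_left]
      rcases le_total d (EscapeOfMass.quotientDegree θ (j + 1)) with h | h
      · rw [Nat.cast_sub h, max_eq_left (sub_nonneg.2 (Nat.cast_le.2 h))]
      · rw [Nat.sub_eq_zero_of_le h, max_eq_right (sub_nonpos.2 (Nat.cast_le.2 h)), Nat.cast_zero]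
    rw [Nat.cast_sum, Finset.sum_congr rfl fun j _ => hterm j, Finset.range_eq_Ico,
      Finset.sum_Ico_add' (fun j => max ((EscapeOfMass.quotientDegree θ j : ℚ) - (d : ℚ)) 0) 0 k 1]
    rfl
  rw [hnum, hden]
  push_cast
  rw [sub_zero, mul_div_mul_left _ _ two_ne_zero]
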